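/- Let $k$ be a finite field with $|k| = q = p^m$, $p$ prime, and let $n, d \ge 0$ be integers. For a set $\mathcal{F}$ of polynomials in a polynomial ring $R$ over $k$ and an integer $i \ge 0$, let $R_{\le i}$ be the $k$-vector space of polynomials of total degree at most $i$, and let $V_{\mathcal{F},i}$ be the smallest $k$-subspace $V \subseteq R$ such that (a) $f \in V$ for every $f \in \mathcal{F}$ with $\deg f \le i$, and (b) $hg \in V$ whenever $g \in V$, $h \in R$ and $\deg(hg) \le i$. The last fall degree $d_{\mathcal{F}}$ is the largest $D \ge 1$ with $V_{\mathcal{F},D} \cap R_{\le D-1} \ne V_{\mathcal{F},D-1}$ (with $d_{\mathcal{F}} = 0$ if there is no such $D$, and $d_{\mathcal{F}} = \infty$ if there are arbitrarily large such $D$). Let $\mathcal{G} = \{g_1, \dots, g_n\}$ with $g_i \in k[x_1, \dots, x_n]$ and $\deg g_i \le d$ for all $i$, and let $f_i \in k[x_i]$ for $i = 1, \dots, n$ be univariate polynomials. Suppose that $\vec g = \rho \circ \vec f \circ \lambda$ with $\rho = (r_{ij})$ and $\lambda = (a_{ij})$ in $GL_n(k)$, that is, $g_i = \sum_{j=1}^n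 r_{ij}\, f_j\bigl(\sum_{l=1}^n a_{jl} x_l\bigr)$ for $i = 1, \dots, n$. Then: (1) $d_{\mathcal{G} \cup \mathcal{E}} \le d + q$ in $k[x_1,\dots,x_n]$, where $\mathcal{E} = \{x_i^q - x_i : i = 1, \dots, n\}$. (2) $d_{\mathcal{G} \cup \mathcal{E}'} \le dp$ in $k[x_{ij} : 1 \le i \le n,\ 0 \le j \le m-1]$, where $\mathcal{E}' = \{x_{ij}^p - x_{i,j+1} : 1 \le i \le n,\ 0 \le j \le m-1\}$ with $j+1$ taken modulo $m$, and where each $g_i(x_1, \dots, x_n) \in \mathcal{G}$ is identified with $g_i(x_{10}, \dots, x_{n0})$. -/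

import Mathlib

open MvPolynomial

/-- `V_{F,i}`: the smallest `k`-subspace `V` of `k[x_s : s ∈ σ]` that contains every `f ∈ F` with
`deg f ≤ i` and is such that `h * g ∈ V` whenever `g ∈ V` and `deg (h * g) ≤ i`. -/
noncomputable def degreeClosure {σ k : Type*} [Field k] (F : Set (MvPolynomial σ k)) (i : ℕ) :
    Submodule k (MvPolynomial σ k) :=
  sInf {V | (∀ f ∈ F, f.totalDegree ≤ i → f ∈ V) ∧
    ∀ g ∈ V, ∀ h : MvPolynomial σ k, (h * g).totalDegree ≤ i → h * g ∈ V}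

/-- There is a degree fall at `D = e + 1`: `V_{F,D} ∩ R_{≤ D-1} ≠ V_{F,D-1}`
(at `D = 0` there is none, since `R_{≤ -1} = 0`). -/
def HasDegreeFall {σ k : Type*} [Field k] (F : Set (MvPolynomial σ k)) (D : ℕ) : Prop :=
  ∃ e : ℕ, D = e + 1 ∧
    degreeClosure F (e + 1) ⊓ restrictTotalDegree σ k e ≠ degreeClosure F e

/-- The last fall degree `d_F`: the largest `D` at which there is a degree fall
(`0` if there is no degree fall, `⊤` if there are degree falls at arbitrarily large `D`). -/
noncomputable def lastFallDegree {σ k : Type*} [Field k] (F : Set (MvPolynomial σ k)) : ℕ∞ :=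
  sSup {N : ℕ∞ | ∃ D : ℕ, HasDegreeFall F D ∧ N = (D : ℕ∞)}

/-- `f ∘ A`: substitute the linear form `∑ j, A i j * x_j` for `x_i`. -/
noncomputable def compLinear {n : ℕ} {k : Type*} [Field k] (f : MvPolynomial (Fin n) k)
    (A : Matrix (Fin n) (Fin n) k) : MvPolynomial (Fin n) k :=
  bind₁ (fun i => ∑ j, C (A i j) * X j) f

/-- `A ∘ f` for a vector `f` of polynomials: the vector with entries `∑ j, A i j * f_j`. -/
noncomputable def linearComp {n : ℕ} {k : Type*} [Field k] (A : Matrix (Fin n) (Fin n) k)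
    (f : Fin n → MvPolynomial (Fin n) k) : Fin n → MvPolynomial (Fin n) k :=
  fun i => ∑ j, C (A i j) * f j

/-- The field equations `x_i ^ q - x_i`. -/
def fieldEquations (n q : ℕ) (k : Type*) [Field k] : Set (MvPolynomial (Fin n) k) :=
  {e | ∃ i : Fin n, e = X i ^ q - X i}

/-- The Frobenius chain equations `x_{i,j} ^ p - x_{i,j+1}`, with `j + 1` taken modulo `m`. -/
def frobeniusEquations (n m p : ℕ) (k : Type*) [Field k] :
    Set (MvPolynomial (Fin n × ZMod m) k) :=
  {e | ∃ (i : Fin n) (j : ZMod m), e = X (i, j) ^ p - X (i, j + 1)}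

/-- The identification of `g(x_1, …, x_n)` with `g(x_{1,0}, …, x_{n,0})`. -/
noncomputable def toChainVariables {n : ℕ} (m : ℕ) {k : Type*} [Field k]
    (g : MvPolynomial (Fin n) k) : MvPolynomial (Fin n × ZMod m) k :=
  rename (fun i => (i, (0 : ZMod m))) g

/-! ### Degree closures and saturation -/

section DegreeClosure

variable {σ σ' k : Type*} [Field k]

/-! If V_{F,D} is all of I ∩ R_{≤ D} for every D ≥ N, where I is an ideal containing F, then no
degree fall occurs beyond N (`SaturatedFrom.lastFallDegree_le`). Both bounds are proved in this form
for the equations x_{i,j}^P = x_{i,j+1}: P = q with chains of length 1, and P = p with chains of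
length m.

The matrix ρ is harmless because V_D is a linear space. The matrix λ is undone by a linear
substitution whose coefficients are twisted by Frobenius along the chain, so that it respects the
chain equations (`chainSubst_frobenius`). What remains is one system per f_i in disjoint blocks of
variables. Saturation passes from the blocks to their union, because interpolation on a finite set
of points need not raise degrees (`exists_interpolation`, `SaturatedFrom.iUnion_rename`).

In a block with f ≠ 0, V_D reduces every polynomial to one in x_0 alone, and Euclidean division
inside V_D concludes (`mem_of_forall_eval_eq_zero`). For f = 0 and P = p, the reduced monomials are
as numerous as the points of k (`saturatedFrom_chainSystem_zero`). -/

theorem subset_degreeClosure {F : Set (MvPolynomial σ k)} {i : ℕ} {f : MvPolynomial σ k}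
    (hf : f ∈ F) (hd : f.totalDegree ≤ i) : f ∈ degreeClosure F i :=
  Submodule.mem_sInf.2 fun _ hV => hV.1 f hf hd

theorem mul_mem_degreeClosure {F : Set (MvPolynomial σ k)} {i : ℕ} {g : MvPolynomial σ k}
    (hg : g ∈ degreeClosure F i) (h : MvPolynomial σ k) (hd : (h * g).totalDegree ≤ i) :
    h * g ∈ degreeClosure F i :=
  Submodule.mem_sInf.2 fun V hV => hV.2 g (Submodule.mem_sInf.1 hg V hV) h hd

theorem degreeClosure_le {F : Set (MvPolynomial σ k)} {i : ℕ} {V : Submodule k (MvPolynomial σ k)}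
    (hF : ∀ f ∈ F, f.totalDegree ≤ i → f ∈ V)
    (hV : ∀ g ∈ V, ∀ h : MvPolynomial σ k, (h * g).totalDegree ≤ i → h * g ∈ V) :
    degreeClosure F i ≤ V :=
  sInf_le ⟨hF, hV⟩

theorem degreeClosure_mono (F : Set (MvPolynomial σ k)) {i j : ℕ} (hij : i ≤ j) :
    degreeClosure F i ≤ degreeClosure F j :=
  degreeClosure_le (fun _ hf hd => subset_degreeClosure hf (hd.trans hij))
    fun _ hg h hd => mul_mem_degreeClosure hg h (hd.trans hij)

theorem degreeClosure_le_restrictTotalDegree (F : Set (MvPolynomial σ k)) (i : ℕ) :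
    degreeClosure F i ≤ restrictTotalDegree σ k i :=
  degreeClosure_le (fun _ _ hd => (mem_restrictTotalDegree _ _ _).2 hd)
    fun _ _ _ hd => (mem_restrictTotalDegree _ _ _).2 hd

theorem totalDegree_le_of_mem_degreeClosure {F : Set (MvPolynomial σ k)} {i : ℕ}
    {f : MvPolynomial σ k} (hf : f ∈ degreeClosure F i) : f.totalDegree ≤ i :=
  (mem_restrictTotalDegree _ _ _).1 (degreeClosure_le_restrictTotalDegree F i hf)

theorem degreeClosure_le_ideal {F : Set (MvPolynomial σ k)} {I : Ideal (MvPolynomial σ k)}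
    (hF : F ⊆ I) (i : ℕ) : degreeClosure F i ≤ I.restrictScalars k :=
  degreeClosure_le (fun _ hf _ => hF hf) fun _ hg h _ => I.mul_mem_left h hg

/-- If `φ` does not raise degrees then it maps `V_{F',i}` into `V_{F,i}`, provided it does so for
the generators. -/
theorem map_mem_degreeClosure {F : Set (MvPolynomial σ k)} {F' : Set (MvPolynomial σ' k)} {i : ℕ}
    (φ : MvPolynomial σ' k →ₐ[k] MvPolynomial σ k) (hφ : ∀ f, (φ f).totalDegree ≤ f.totalDegree)
    (hF : ∀ f ∈ F', f.totalDegree ≤ i → φ f ∈ degreeClosure F i) {f : MvPolynomial σ' k}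
    (hf : f ∈ degreeClosure F' i) : φ f ∈ degreeClosure F i := by
  have : degreeClosure F' i ≤ (degreeClosure F i).comap φ.toLinearMap := by
    refine degreeClosure_le hF fun g hg h hd => ?_
    simp only [Submodule.mem_comap, AlgHom.toLinearMap_apply, map_mul] at hg ⊢
    exact mul_mem_degreeClosure hg _ (by rw [← map_mul]; exact (hφ _).trans hd)
  exact this hf

/-- From degree `N` on, `V_{F,D}` is all of `I ∩ R_{≤ D}`. -/
def SaturatedFrom (F : Set (MvPolynomial σ k)) (I : Ideal (MvPolynomial σ k)) (N : ℕ) : Prop :=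
  ∀ D, N ≤ D → ∀ f ∈ I, f.totalDegree ≤ D → f ∈ degreeClosure F D

theorem SaturatedFrom.lastFallDegree_le {F : Set (MvPolynomial σ k)}
    {I : Ideal (MvPolynomial σ k)} {N : ℕ} (h : SaturatedFrom F I N) (hF : F ⊆ I) :
    lastFallDegree F ≤ (N : ℕ∞) := by
  refine sSup_le ?_
  rintro _ ⟨_, ⟨e, rfl, he⟩, rfl⟩
  by_contra! hlt
  -- A fall at D = e + 1 concerns V_e, so saturation already at e = N gives the bound N and not N +
  -- 1.
  have hN : N ≤ e := by
    have : N < e + 1 := by exact_mod_cast hlt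
    omega
  refine he (le_antisymm ?_ (le_inf (degreeClosure_mono F e.le_succ)
    (degreeClosure_le_restrictTotalDegree F e)))
  rintro f ⟨hf, hfe⟩
  exact h e hN f (degreeClosure_le_ideal hF _ hf) ((mem_restrictTotalDegree _ _ _).1 hfe)

/-- Saturation is transported along a degree-preserving change of variables. -/
theorem SaturatedFrom.comap {F : Set (MvPolynomial σ k)} {F' : Set (MvPolynomial σ' k)}
    {I' : Ideal (MvPolynomial σ' k)} {N : ℕ} (h : SaturatedFrom F' I' N)
    (φ : MvPolynomial σ k →ₐ[k] MvPolynomial σ' k) (ψ : MvPolynomial σ' k →ₐ[k] MvPolynomial σ k)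
    (hφ : ∀ f, (φ f).totalDegree ≤ f.totalDegree) (hψ : ∀ f, (ψ f).totalDegree ≤ f.totalDegree)
    (hψφ : ∀ f, ψ (φ f) = f)
    (hF : ∀ D, N ≤ D → ∀ f ∈ F', f.totalDegree ≤ D → ψ f ∈ degreeClosure F D) :
    SaturatedFrom F (I'.comap φ) N := by
  intro D hD f hf hfD
  rw [← hψφ f]
  exact map_mem_degreeClosure ψ hψ (hF D hD) (h D hD _ hf ((hφ f).trans hfD))

theorem mem_degreeClosure_of_C_mem {F : Set (MvPolynomial σ k)} {i : ℕ} {c : k} (hc : c ≠ 0)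
    (h : C c ∈ degreeClosure F i) {f : MvPolynomial σ k} (hf : f.totalDegree ≤ i) :
    f ∈ degreeClosure F i := by
  have hfc : f * C c⁻¹ * C c = f := by
    rw [mul_assoc, ← C_mul, inv_mul_cancel₀ hc, C_1, mul_one]
  rw [← hfc]
  exact mul_mem_degreeClosure h _ (by rwa [hfc])

end DegreeClosure

/-! ### Degrees under substitution -/

section TotalDegree

variable {σ σ' k : Type*} [Field k]

theorem totalDegree_aeval_le_of_totalDegree_le_one {g : σ → MvPolynomial σ' k}
    (hg : ∀ i, (g i).totalDegree ≤ 1) (f : MvPolynomial σ k) :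
    (aeval g f).totalDegree ≤ f.totalDegree := by
  rw [aeval_def, eval₂_eq]
  refine totalDegree_finsetSum_le fun a ha => ?_
  rw [algebraMap_eq]
  refine (totalDegree_mul _ _).trans ?_
  rw [totalDegree_C, zero_add]
  refine (totalDegree_finsetProd _ _).trans (le_trans ?_ (le_totalDegree ha))
  refine Finset.sum_le_sum fun i _ => (totalDegree_pow _ _).trans ?_
  simpa using Nat.mul_le_mul_left (a i) (hg i)

theorem totalDegree_aeval_X_le (i : σ) (u : Polynomial k) :
    (Polynomial.aeval (X i : MvPolynomial σ k) u).totalDegree ≤ u.natDegree := by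
  rw [Polynomial.aeval_eq_sum_range]
  refine totalDegree_finsetSum_le fun j hj => ?_
  refine (totalDegree_smul_le _ _).trans ?_
  rw [totalDegree_X_pow]
  exact Nat.lt_succ_iff.1 (Finset.mem_range.1 hj)

theorem natDegree_aeval_X_le (f : MvPolynomial σ k) :
    (aeval (fun _ => Polynomial.X) f : Polynomial k).natDegree ≤ f.totalDegree := by
  simpa using aeval_natDegree_le f le_rfl (fun _ => (Polynomial.X : Polynomial k))
    (fun _ => Polynomial.natDegree_X_le)

/-- Sending every variable to X is a left inverse of u ↦ u(x_i) and does not raise degrees. -/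
theorem natDegree_le_totalDegree_aeval_X (i : σ) (u : Polynomial k) :
    u.natDegree ≤ (Polynomial.aeval (X i : MvPolynomial σ k) u).totalDegree := by
  have h := natDegree_aeval_X_le (Polynomial.aeval (X i : MvPolynomial σ k) u)
  rwa [← Polynomial.aeval_algHom_apply, aeval_X, Polynomial.aeval_X_left_apply] at h

theorem totalDegree_sum_C_mul_X_le {ι : Type*} (s : Finset ι) (c : ι → k) (v : ι → σ) :
    (∑ i ∈ s, C (c i) * X (v i) : MvPolynomial σ k).totalDegree ≤ 1 :=
  totalDegree_finsetSum_le fun i _ => (totalDegree_mul _ _).trans (by simp)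

/-- For P = 1 and i = j the difference would be zero. -/
theorem totalDegree_X_pow_sub_X {P : ℕ} (hP : 2 ≤ P) (i j : σ) :
    (X i ^ P - X j : MvPolynomial σ k).totalDegree = P := by
  rw [sub_eq_add_neg, totalDegree_add_eq_left_of_totalDegree_lt, totalDegree_X_pow]
  rw [totalDegree_neg, totalDegree_X, totalDegree_X_pow]
  omega

end TotalDegree

/-! ### Interpolation without raising degrees -/

section Interpolation

/-- A linear map out of a filtered space onto a finite-dimensional space has a section that is
compatible with the filtration. -/
theorem exists_filtered_section {k R W : Type*} [Field k] [AddCommGroup R] [Module k R]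
    [AddCommGroup W] [Module k W] (ev : R →ₗ[k] W) (A : ℕ → Submodule k R) (hA : Monotone A)
    {N : ℕ} (hN : ∀ w : W, ∃ g ∈ A N, ev g = w) :
    ∃ s : W →ₗ[k] R, (∀ w, ev (s w) = w) ∧ ∀ e, ∀ g ∈ A e, s (ev g) ∈ A e := by
  -- `t d` lifts the image of A d back into A d; `π d` below projects W onto that image.
  have ht : ∀ d, ∃ t : W →ₗ[k] R, (∀ w, t w ∈ A d) ∧ ∀ w ∈ (A d).map ev, ev (t w) = w := by
    intro d
    obtain ⟨π, hπ⟩ := LinearMap.exists_leftInverse_of_injective ((A d).map ev).subtype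
      (Submodule.ker_subtype _)
    obtain ⟨t, ht⟩ := LinearMap.exists_rightInverse_of_surjective
      ((ev.domRestrict (A d)).codRestrict ((A d).map ev)
        (fun g => Submodule.mem_map_of_mem g.2)) (by
          rw [LinearMap.range_eq_top]
          rintro ⟨_, g, hg, rfl⟩
          exact ⟨⟨g, hg⟩, rfl⟩)
    refine ⟨(A d).subtype ∘ₗ t ∘ₗ π, fun w => (t (π w)).2, fun w hw => ?_⟩
    have h1 : π w = ⟨w, hw⟩ := LinearMap.congr_fun hπ ⟨w, hw⟩
    have h2 := congrArg Subtype.val (LinearMap.congr_fun ht ⟨w, hw⟩)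
    change ev (t (π w)) = w
    rw [h1]
    exact h2
  have hπ : ∀ d, ∃ π : W →ₗ[k] W, (∀ w, π w ∈ (A d).map ev) ∧ ∀ w ∈ (A d).map ev, π w = w := by
    intro d
    obtain ⟨π, hπ⟩ := LinearMap.exists_leftInverse_of_injective ((A d).map ev).subtype
      (Submodule.ker_subtype _)
    exact ⟨((A d).map ev).subtype ∘ₗ π, fun w => (π w).2,
      fun w hw => congrArg Subtype.val (LinearMap.congr_fun hπ ⟨w, hw⟩)⟩
  choose t ht1 ht2 using ht
  choose π hπ1 hπ2 using hπ
  have hmono : ∀ {d e w}, d ≤ e → w ∈ (A d).map ev → w ∈ (A e).map ev :=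
    fun h hw => Submodule.map_mono (hA h) hw
  -- Each increment of the projections is lifted at its own level. For g ∈ A e, the increments with
  -- d ≥ e vanish, since both projections fix ev g, and the others lift into A e.
  refine ⟨t 0 ∘ₗ π 0 + ∑ d ∈ Finset.range N, t (d + 1) ∘ₗ (π (d + 1) - π d), fun w => ?_,
    fun e g hg => ?_⟩
  · have h1 : ∀ d, ev (t (d + 1) (π (d + 1) w - π d w)) = π (d + 1) w - π d w := fun d =>
      ht2 _ _ (Submodule.sub_mem _ (hπ1 _ _) (hmono d.le_succ (hπ1 _ _)))
    have hw : w ∈ (A N).map ev := by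
      obtain ⟨g, hg, rfl⟩ := hN w
      exact Submodule.mem_map_of_mem hg
    simp only [LinearMap.add_apply, LinearMap.sum_apply, LinearMap.comp_apply,
      LinearMap.sub_apply, map_add, map_sum, h1, Finset.sum_range_sub (fun d => π d w),
      ht2 0 _ (hπ1 0 w), hπ2 N w hw]
    abel
  · simp only [LinearMap.add_apply, LinearMap.sum_apply, LinearMap.comp_apply,
      LinearMap.sub_apply]
    refine Submodule.add_mem _ (hA (Nat.zero_le e) (ht1 _ _)) (Submodule.sum_mem _ fun d _ => ?_)
    have hge : ev g ∈ (A e).map ev := Submodule.mem_map_of_mem hg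
    rcases Nat.lt_or_ge d e with hd | hd
    · exact hA hd (ht1 _ _)
    · rw [hπ2 d _ (hmono hd hge), hπ2 (d + 1) _ (hmono (by omega) hge), sub_self, map_zero]
      exact Submodule.zero_mem _

variable {τ k : Type*} [Field k] [Finite k] [Finite τ]

/-- Polynomials dual to the points of `Z` such that interpolation does not raise the degree. -/
theorem exists_interpolation (Z : Finset (τ → k)) :
    ∃ u : (τ → k) → MvPolynomial τ k,
      (∀ g : MvPolynomial τ k, (∑ z ∈ Z, eval z g • u z).totalDegree ≤ g.totalDegree) ∧
      ∀ g : MvPolynomial τ k, ∀ y ∈ Z, eval y (∑ z ∈ Z, eval z g • u z) = eval y g := by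
  classical
  cases nonempty_fintype k
  cases nonempty_fintype τ
  let ev : MvPolynomial τ k →ₗ[k] (Z → k) := LinearMap.funLeft k k Subtype.val ∘ₗ evalₗ k τ
  have hev : ∀ g z, ev g z = eval z.1 g := fun g z => rfl
  have hmono : Monotone (restrictTotalDegree τ k) := fun a b hab f hf =>
    (mem_restrictTotalDegree _ _ _).2 (((mem_restrictTotalDegree _ _ _).1 hf).trans hab)
  -- The indicator polynomials of the points realise every function on Z, within this degree.
  let N := Finset.univ.sup fun y : τ → k => (indicator y).totalDegree
  obtain ⟨s, hs1, hs2⟩ := exists_filtered_section ev (restrictTotalDegree τ k) hmono (N := N) (by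
    intro w
    refine ⟨∑ z : Z, w z • indicator z.1, Submodule.sum_mem _ fun z _ => Submodule.smul_mem _ _
      ((mem_restrictTotalDegree _ _ _).2 (Finset.le_sup (f := fun y : τ → k =>
        (indicator y).totalDegree) (Finset.mem_univ z.1))), ?_⟩
    ext y
    rw [hev, map_sum, Finset.sum_eq_single y]
    · simp [smul_eval, eval_indicator_apply_eq_one]
    · intro z _ hz
      rw [smul_eval, eval_indicator_apply_eq_zero _ _ (fun h => hz (Subtype.ext h.symm)), mul_zero]
    · simp)
  refine ⟨fun z => if h : z ∈ Z then s (Pi.single ⟨z, h⟩ 1) else 0, ?_⟩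
  have key : ∀ g, (∑ z ∈ Z, eval z g • (if h : z ∈ Z then s (Pi.single ⟨z, h⟩ 1) else 0))
      = s (ev g) := by
    intro g
    rw [← Finset.sum_attach]
    have : ev g = ∑ z ∈ Z.attach, ev g z • Pi.single z (1 : k) := by
      ext y
      simp [Finset.sum_apply, Pi.single_apply]
    rw [this, map_sum]
    refine Finset.sum_congr rfl fun z _ => ?_
    rw [dif_pos z.2, map_smul, hev]
  refine ⟨fun g => ?_, fun g y hy => ?_⟩
  · rw [key]
    exact (mem_restrictTotalDegree _ _ _).1 (hs2 _ g ((mem_restrictTotalDegree _ _ _).2 le_rfl))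
  · rw [key]
    exact congrFun (hs1 (ev g)) ⟨y, hy⟩

end Interpolation

/-! ### Disjoint blocks of variables -/

section Product

variable {ι τ k : Type*} [Field k]

/-- Exchange one factor at a time; the weights bound both products alike, so no intermediate product
exceeds degree D. -/
theorem prod_sub_prod_mem_degreeClosure {σ : Type*} {F : Set (MvPolynomial σ k)} {D : ℕ}
    (A B : ι → MvPolynomial σ k) (w : ι → ℕ) (hA : ∀ i, (A i).totalDegree ≤ w i)
    (hB : ∀ i, (B i).totalDegree ≤ w i) (s : Finset ι) (hs : ∑ i ∈ s, w i ≤ D)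
    (h : ∀ i ∈ s, A i - B i ∈ degreeClosure F D) :
    ∏ i ∈ s, A i - ∏ i ∈ s, B i ∈ degreeClosure F D := by
  classical
  have hdeg : ∀ (A : ι → MvPolynomial σ k), (∀ i, (A i).totalDegree ≤ w i) →
      ∀ s : Finset ι, (∏ i ∈ s, A i).totalDegree ≤ ∑ i ∈ s, w i := fun A hA s =>
    (totalDegree_finsetProd _ _).trans (Finset.sum_le_sum fun i _ => hA i)
  have hsub : ∀ {a b : MvPolynomial σ k} {n : ℕ}, a.totalDegree ≤ n → b.totalDegree ≤ n →
      (a - b).totalDegree ≤ n := fun ha hb => (totalDegree_sub _ _).trans (max_le ha hb)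
  induction s using Finset.induction_on with
  | empty => simp
  | insert j s hj ih =>
    rw [Finset.sum_insert hj] at hs
    rw [Finset.prod_insert hj, Finset.prod_insert hj]
    have e : A j * ∏ i ∈ s, A i - B j * ∏ i ∈ s, B i =
        (∏ i ∈ s, A i) * (A j - B j) + B j * (∏ i ∈ s, A i - ∏ i ∈ s, B i) := by ring
    rw [e]
    refine Submodule.add_mem _ (mul_mem_degreeClosure (h j (Finset.mem_insert_self _ _)) _ ?_)
      (mul_mem_degreeClosure
        (ih (by omega) fun i hi => h i (Finset.mem_insert_of_mem hi)) _ ?_)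
    · refine (totalDegree_mul _ _).trans ?_
      have := hdeg A hA s
      have := hsub (hA j) (hB j)
      omega
    · refine (totalDegree_mul _ _).trans ?_
      have := hsub (hdeg A hA s) (hdeg B hB s)
      have := hB j
      omega

/-- The points all of whose blocks lie in the given sets. -/
def blockPoints (Z : ι → Set (τ → k)) : Set (ι × τ → k) :=
  {y | ∀ i, (fun j => y (i, j)) ∈ Z i}

/-- If each block system `F i` is saturated from degree `N` on, then so is their union in disjoint
sets of variables. -/
theorem SaturatedFrom.iUnion_rename [Fintype ι] [Finite τ] [Finite k]
    (F : ι → Set (MvPolynomial τ k)) (Z : ι → Set (τ → k)) {N : ℕ}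
    (h : ∀ i, SaturatedFrom (F i) (vanishingIdeal k (Z i)) N) :
    SaturatedFrom (⋃ i, rename (Prod.mk i) '' F i)
      (vanishingIdeal k (blockPoints Z)) N := by
  classical
  cases nonempty_fintype k
  cases nonempty_fintype τ
  let Zf : ι → Finset (τ → k) := fun i => (Z i).toFinset
  choose u hu1 hu2 using fun i => exists_interpolation (Zf i)
  set G := ⋃ i, rename (Prod.mk i) '' F i with hG
  let ζ : (ι → τ → k) → ι × τ → k := fun z x => z x.1 x.2
  -- The interpolant of f at the product points. It is linear in f and depends only on the values
  -- there, so it kills the vanishing ideal, and f becomes a combination of differences `monomial a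
  -- 1 - nf (monomial a 1)`.
  let nf : MvPolynomial (ι × τ) k → MvPolynomial (ι × τ) k := fun f =>
    ∑ z ∈ Fintype.piFinset Zf, eval (ζ z) f • ∏ i, rename (Prod.mk i) (u i (z i))
  have nf_sum : ∀ f : MvPolynomial (ι × τ) k,
      nf f = ∑ a ∈ f.support, coeff a f • nf (monomial a 1) := by
    intro f
    simp only [nf, Finset.smul_sum]
    rw [Finset.sum_comm]
    refine Finset.sum_congr rfl fun z _ => ?_
    simp only [smul_smul, ← Finset.sum_smul]
    congr 1
    conv_lhs => rw [f.as_sum, map_sum]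
    refine Finset.sum_congr rfl fun a _ => ?_
    simp [eval_monomial]
  intro D hD f hf hfD
  have hnf0 : nf f = 0 := by
    refine Finset.sum_eq_zero fun z hz => ?_
    have : eval (ζ z) f = 0 := by
      refine (mem_vanishingIdeal_iff.1 hf) (ζ z) fun i => ?_
      simpa [Zf] using Fintype.mem_piFinset.1 hz i
    rw [this, zero_smul]
  have hmon : ∀ a : ι × τ →₀ ℕ, a.degree ≤ D →
      monomial a 1 - nf (monomial a 1) ∈ degreeClosure G D := by
    intro a ha
    let M : ι → MvPolynomial τ k := fun i => ∏ j, X j ^ a (i, j)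
    let w : ι → ℕ := fun i => ∑ j, a (i, j)
    have hM : ∀ i, (M i).totalDegree ≤ w i := fun i =>
      (totalDegree_finsetProd _ _).trans (Finset.sum_le_sum fun j _ => by
        rw [totalDegree_X_pow])
    have hw : ∑ i, w i ≤ D := by
      rw [Finsupp.degree_eq_sum, Fintype.sum_prod_type] at ha
      exact ha
    have h1 : monomial a (1 : k) = ∏ i, rename (Prod.mk i) (M i) := by
      rw [monomial_eq, C_1, one_mul, Finsupp.prod_fintype _ _ (fun _ => pow_zero _),
        Fintype.prod_prod_type]
      simp [M]
    -- On a monomial `nf` factors into blockwise interpolants `B i` of `M i`. Each `M i - B i`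
    -- vanishes on `Z i`, so block saturation applies to it.
    let B : ι → MvPolynomial τ k := fun i => ∑ z ∈ Zf i, eval z (M i) • u i z
    have h2 : nf (monomial a 1) = ∏ i, rename (Prod.mk i) (B i) := by
      simp only [B, map_sum]
      rw [Finset.prod_univ_sum]
      refine Finset.sum_congr rfl fun z _ => ?_
      rw [h1, map_prod]
      simp only [map_smul]
      rw [Finset.prod_smul]
      congr 1
      refine Finset.prod_congr rfl fun i _ => ?_
      rw [eval_rename]
      rfl
    rw [h2, h1]
    have hB : ∀ i, (B i).totalDegree ≤ w i := fun i => (hu1 i _).trans (hM i)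
    refine prod_sub_prod_mem_degreeClosure _ _ w
      (fun i => (totalDegree_rename_le _ _).trans (hM i))
      (fun i => (totalDegree_rename_le _ _).trans (hB i)) _ hw fun i _ => ?_
    rw [← map_sub]
    have hwi : w i ≤ D := (Finset.single_le_sum (fun _ _ => Nat.zero_le _)
      (Finset.mem_univ i)).trans hw
    refine map_mem_degreeClosure (F' := F i) (rename (Prod.mk i))
      (fun g => totalDegree_rename_le _ g) (fun g hg hd => ?_) ?_
    · exact subset_degreeClosure (Set.mem_iUnion.2 ⟨i, g, hg, rfl⟩)
        ((totalDegree_rename_le _ g).trans hd)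
    · refine h i D hD _ (mem_vanishingIdeal_iff.2 fun y hy => ?_)
        ((totalDegree_sub _ _).trans (max_le ((hM i).trans hwi) ((hB i).trans hwi)))
      have := hu2 i (M i) y (by simpa [Zf] using hy)
      simp only [aeval_eq_eval, map_sub]
      simp only [B]
      exact sub_eq_zero.2 this.symm
  have : f = ∑ a ∈ f.support, coeff a f • (monomial a 1 - nf (monomial a 1)) := by
    simp only [smul_sub, Finset.sum_sub_distrib]
    rw [← nf_sum, hnf0, sub_zero]
    conv_lhs => rw [f.as_sum]
    refine Finset.sum_congr rfl fun a _ => ?_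
    rw [smul_monomial, smul_eq_mul, mul_one]
  rw [this]
  refine Submodule.sum_mem _ fun a ha => Submodule.smul_mem _ _ (hmon a ?_)
  exact (le_totalDegree ha).trans hfD

end Product

/-! ### Univariate polynomials over a finite field -/

section Univariate

variable {k : Type*} [Field k] [Fintype k]

theorem splits_X_pow_card_sub_X_self :
    ((Polynomial.X ^ Fintype.card k - Polynomial.X : Polynomial k)).Splits := by
  rw [Polynomial.splits_iff_card_roots, FiniteField.roots_X_pow_card_sub_X,
    FiniteField.X_pow_card_sub_X_natDegree_eq k Fintype.one_lt_card]
  rfl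

/-- Such an h splits over k with simple roots, so divisibility by it can be tested at its roots. -/
theorem dvd_of_dvd_X_pow_card_sub_X {h u : Polynomial k}
    (hh : h ∣ Polynomial.X ^ Fintype.card k - Polynomial.X)
    (hu : ∀ x, h.eval x = 0 → u.eval x = 0) : h ∣ u := by
  classical
  have hne : (Polynomial.X ^ Fintype.card k - Polynomial.X : Polynomial k) ≠ 0 :=
    FiniteField.X_pow_card_sub_X_ne_zero k Fintype.one_lt_card
  have hh0 : h ≠ 0 := ne_zero_of_dvd_ne_zero hne hh
  have hsp : h.Splits := splits_X_pow_card_sub_X_self.of_dvd hne hh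
  have hnd : h.roots.Nodup := by
    refine Multiset.nodup_of_le (Polynomial.roots.le_of_dvd hne hh) ?_
    rw [FiniteField.roots_X_pow_card_sub_X]
    exact Finset.univ.nodup
  by_cases h0 : u = 0
  · simp [h0]
  refine (Polynomial.Splits.dvd_iff_roots_le_roots hsp hh0 h0).2 ?_
  rw [Multiset.le_iff_subset hnd]
  intro x hx
  rw [Polynomial.mem_roots hh0] at hx
  exact (Polynomial.mem_roots h0).2 (hu x hx)

/-- A space of polynomials of degree at most `D` that is closed under multiplication within degree
`D` and contains `f` and a representative of `X ^ q - X` modulo `f` contains all polynomials of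
degree at most `D` that vanish at the roots of `f` in `k`. -/
theorem mem_of_forall_eval_eq_zero (J : Submodule k (Polynomial k)) (D : ℕ)
    (hJ : ∀ u ∈ J, ∀ c : Polynomial k, (c * u).natDegree ≤ D → c * u ∈ J)
    {f w : Polynomial k} (hf : f ∈ J) (hw : w ∈ J) (hfD : f.natDegree ≤ D) (hwD : w.natDegree ≤ D)
    (hfw : f ∣ Polynomial.X ^ Fintype.card k - Polynomial.X - w)
    {u : Polynomial k} (hu : u.natDegree ≤ D) (hz : ∀ x, f.eval x = 0 → u.eval x = 0) :
    u ∈ J := by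
  classical
  have hne : (Polynomial.X ^ Fintype.card k - Polynomial.X : Polynomial k) ≠ 0 :=
    FiniteField.X_pow_card_sub_X_ne_zero k Fintype.one_lt_card
  -- A nonzero element of minimal degree in J will play the role of the gcd. If f = 0, the
  -- congruence forces w = X ^ q - X, so J still contains a nonzero element.
  have hex : ∃ n, ∃ v ∈ J, v ≠ 0 ∧ v.natDegree = n ∧ n ≤ D := by
    by_cases h0 : f = 0
    · refine ⟨_, w, hw, ?_, rfl, hwD⟩
      rintro rfl
      rw [h0, zero_dvd_iff, sub_zero] at hfw
      exact hne hfw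
    · exact ⟨_, f, hf, h0, rfl, hfD⟩
  obtain ⟨h, hhJ, hh0, hhn, hhD⟩ := Nat.find_spec hex
  have hmin : ∀ v ∈ J, v ≠ 0 → v.natDegree ≤ D → h.natDegree ≤ v.natDegree := by
    intro v hv hv0 hvD
    rw [hhn]
    exact Nat.find_min' hex ⟨v, hv, hv0, rfl, hvD⟩
  rw [← hhn] at hhD
  have hmod : ∀ v : Polynomial k, (v % h).natDegree ≤ h.natDegree := fun v =>
    Polynomial.natDegree_le_natDegree (Polynomial.degree_mod_lt v hh0).le
  have hdiv : ∀ v : Polynomial k, v.natDegree ≤ D → v - v % h ∈ J := by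
    intro v hvD
    have e : v - v % h = v / h * h := by
      rw [EuclideanDomain.mod_eq_sub_mul_div]
      ring
    rw [e]
    refine hJ h hhJ _ ?_
    rw [← e]
    exact (Polynomial.natDegree_sub_le _ _).trans (max_le hvD ((hmod v).trans hhD))
  have hdvd : ∀ v ∈ J, v.natDegree ≤ D → h ∣ v := by
    intro v hv hvD
    rw [← EuclideanDomain.mod_eq_zero]
    by_contra hne0
    have hmem : v % h ∈ J := by
      have := Submodule.sub_mem _ hv (hdiv v hvD)
      rwa [sub_sub_cancel] at this
    have h1 := hmin _ hmem hne0 ((hmod v).trans hhD)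
    have h2 := Polynomial.degree_mod_lt v hh0
    rw [Polynomial.degree_eq_natDegree hne0, Polynomial.degree_eq_natDegree hh0] at h2
    have h3 : (v % h).natDegree < h.natDegree := by exact_mod_cast h2
    omega
  have hhf := hdvd f hf hfD
  -- Dividing f and w, h divides X ^ q - X, and its roots are roots of f, hence of u.
  have hhq : h ∣ Polynomial.X ^ Fintype.card k - Polynomial.X := by
    have := dvd_add (hhf.trans hfw) (hdvd w hw hwD)
    rwa [sub_add_cancel] at this
  have hhu : h ∣ u := by
    refine dvd_of_dvd_X_pow_card_sub_X hhq fun x hx => hz x ?_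
    obtain ⟨c, rfl⟩ := hhf
    rw [Polynomial.eval_mul, hx, zero_mul]
  have := hdiv u hu
  rwa [(EuclideanDomain.mod_eq_zero).2 hhu, sub_zero] at this

end Univariate

/-! ### Frobenius chains, the one-variable case and the case f = 0 -/

section Chain

variable {k : Type*} [Field k] {m P : ℕ}

/-- The system of `f(x_0)` and the equations `x_j ^ P - x_{j+1}` in the variables `x_j`, with `j`
modulo `m`. -/
def chainSystem (m P : ℕ) (f : Polynomial k) : Set (MvPolynomial (ZMod m) k) :=
  {e | e = Polynomial.aeval (X 0) f ∨ ∃ j, e = X j ^ P - X (j + 1)}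

/-- The point `x_j = x ^ (P ^ j)`. -/
def chainPoint (m P : ℕ) (x : k) : ZMod m → k := fun j => x ^ P ^ j.val

/-- The zeros of `chainSystem m P f`. -/
def chainZeros (m P : ℕ) (f : Polynomial k) : Set (ZMod m → k) :=
  {z | ∃ x, f.eval x = 0 ∧ z = chainPoint m P x}

theorem chainPoint_zero [NeZero m] (x : k) : chainPoint m P x 0 = x := by
  simp [chainPoint]

/-- The monomial `∏ x_j ^ (a_j)` with exponents less than `P`. -/
noncomputable def reducedMonomial {m P : ℕ} [NeZero m] (a : ZMod m → Fin P) :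
    MvPolynomial (ZMod m) k :=
  monomial (Finsupp.equivFunOnFinite.symm fun j => (a j : ℕ)) 1

/-- Replacing x_j^P by x_{j+1} strictly lowers the degree because P ≥ 2, so the rewriting terminates
and never leaves degree D. -/
theorem mem_degreeClosure_sup_span_reducedMonomial [NeZero m] (hP : 2 ≤ P) (f : Polynomial k)
    {D : ℕ} {g : MvPolynomial (ZMod m) k} (hg : g.totalDegree ≤ D) :
    g ∈ degreeClosure (chainSystem m P f) D ⊔
      Submodule.span k (Set.range (reducedMonomial (k := k) (m := m) (P := P))) := by
  have key : ∀ n, ∀ b : ZMod m →₀ ℕ, b.degree = n → n ≤ D →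
      monomial b (1 : k) ∈ degreeClosure (chainSystem m P f) D ⊔
        Submodule.span k (Set.range (reducedMonomial (k := k) (m := m) (P := P))) := by
    intro n
    induction n using Nat.strong_induction_on with
    | _ n ih =>
      intro b hb hn
      by_cases hlt : ∀ j, b j < P
      · refine Submodule.mem_sup_right (Submodule.subset_span ⟨fun j => ⟨b j, hlt j⟩, ?_⟩)
        exact congrArg (fun c => monomial c 1) (Finsupp.ext fun _ => rfl)
      · push Not at hlt
        obtain ⟨j, hj⟩ := hlt
        obtain ⟨b', rfl⟩ : ∃ b', b = b' + Finsupp.single j P :=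
          ⟨b - Finsupp.single j P, (tsub_add_cancel_of_le (by simpa using hj)).symm⟩
        have e : monomial (b' + Finsupp.single j P) (1 : k) =
            monomial b' 1 * (X j ^ P - X (j + 1)) +
              monomial (b' + Finsupp.single (j + 1) 1) 1 := by
          rw [X_pow_eq_monomial, mul_sub, monomial_mul, X, monomial_mul]
          simp
        rw [map_add, Finsupp.degree_single] at hb
        rw [e]
        refine Submodule.add_mem _ (Submodule.mem_sup_left (mul_mem_degreeClosure
          (subset_degreeClosure (Or.inr ⟨j, rfl⟩) ?_) _ ?_)) (ih (b'.degree + 1) (by omega) _ ?_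
            (by omega))
        · rw [totalDegree_X_pow_sub_X hP]
          omega
        · refine (totalDegree_mul _ _).trans ?_
          rw [totalDegree_X_pow_sub_X hP, totalDegree_monomial _ one_ne_zero]
          change b'.degree + P ≤ D
          omega
        · rw [map_add, Finsupp.degree_single]
  rw [g.as_sum]
  refine Submodule.sum_mem _ fun a ha => ?_
  rw [← mul_one (coeff a g), ← smul_eq_mul, ← smul_monomial]
  exact Submodule.smul_mem _ _ (key _ a rfl ((le_totalDegree ha).trans hg))

variable [Fintype k]

/-- Since x^(P^m) = x, the power x^(P^r) depends only on r modulo m. -/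
theorem pow_pow_val_natCast [NeZero m] (hq : Fintype.card k = P ^ m) (x : k) (r : ℕ) :
    x ^ P ^ (r : ZMod m).val = x ^ P ^ r := by
  conv_rhs => rw [← Nat.div_add_mod r m, pow_add, pow_mul, pow_mul P m, ← hq, FiniteField.pow_card_pow]
  rw [ZMod.val_natCast]

theorem pow_pow_val_add_one [NeZero m] (hq : Fintype.card k = P ^ m) (x : k) (j : ZMod m) :
    x ^ P ^ (j + 1).val = (x ^ P ^ j.val) ^ P := by
  have : j + 1 = ((j.val + 1 : ℕ) : ZMod m) := by
    rw [Nat.cast_add, ZMod.natCast_zmod_val, Nat.cast_one]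
  rw [this, pow_pow_val_natCast hq, pow_succ, pow_mul]

theorem chainSystem_subset_vanishingIdeal [NeZero m] (hq : Fintype.card k = P ^ m)
    (f : Polynomial k) :
    chainSystem m P f ⊆ (vanishingIdeal k (chainZeros m P f) : Set (MvPolynomial (ZMod m) k)) := by
  rintro _ (rfl | ⟨j, rfl⟩) _ ⟨x, hx, rfl⟩
  · rw [← Polynomial.aeval_algHom_apply, aeval_X, chainPoint_zero]
    simpa using hx
  · simp only [map_sub, map_pow, aeval_X, chainPoint]
    rw [pow_pow_val_add_one hq, sub_self]

/-- A polynomial in `x_0` of degree at most `D` that vanishes at the roots of `f` lies in `V_D`,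
provided that `V_D` contains some `w(x_0)` with `w ≡ X ^ q - X` modulo `f`. -/
theorem aeval_X_zero_mem_degreeClosure {F : Set (MvPolynomial (ZMod m) k)} {D : ℕ}
    {f w u : Polynomial k} (hf : Polynomial.aeval (X 0) f ∈ degreeClosure F D)
    (hw : Polynomial.aeval (X 0) w ∈ degreeClosure F D)
    (hfw : f ∣ Polynomial.X ^ Fintype.card k - Polynomial.X - w)
    (hu : u.natDegree ≤ D) (hz : ∀ x, f.eval x = 0 → u.eval x = 0) :
    Polynomial.aeval (X 0) u ∈ degreeClosure F D := by
  have hdeg : ∀ v : Polynomial k, Polynomial.aeval (X 0) v ∈ degreeClosure F D →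
      v.natDegree ≤ D := fun v hv =>
    (natDegree_le_totalDegree_aeval_X 0 v).trans (totalDegree_le_of_mem_degreeClosure hv)
  refine mem_of_forall_eval_eq_zero ((degreeClosure F D).comap
    (Polynomial.aeval (X 0 : MvPolynomial (ZMod m) k)).toLinearMap) D ?_ hf hw
    (hdeg f hf) (hdeg w hw) hfw hu hz
  intro v hv c hcv
  simp only [Submodule.mem_comap, AlgHom.toLinearMap_apply, map_mul] at hv ⊢
  refine mul_mem_degreeClosure hv _ ?_
  rw [← map_mul]
  exact (totalDegree_aeval_X_le _ _).trans hcv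

/-- The case of a single variable. -/
theorem saturatedFrom_chainSystem_one {q d : ℕ} (hq : Fintype.card k = q) (f : Polynomial k)
    (hd : f.natDegree ≤ d) :
    SaturatedFrom (chainSystem 1 q f) (vanishingIdeal k (chainZeros 1 q f)) (d + q) := by
  intro D hD g hg hgD
  have hq2 : 2 ≤ q := hq ▸ Fintype.one_lt_card
  have e : g = Polynomial.aeval (X 0) (aeval (fun _ => Polynomial.X) g : Polynomial k) := by
    have : ((Polynomial.aeval (X 0 : MvPolynomial (ZMod 1) k)).comp
        (aeval (fun _ => Polynomial.X : ZMod 1 → Polynomial k))) = AlgHom.id k _ := by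
      ext j
      simp [Subsingleton.elim j 0]
    exact (AlgHom.congr_fun this g).symm
  rw [e]
  -- The bound d + q serves only to ensure that f and X ^ q - X, of degrees at most d and q, both
  -- enter V_D.
  refine aeval_X_zero_mem_degreeClosure (f := f)
    (w := Polynomial.X ^ Fintype.card k - Polynomial.X) ?_ ?_ ?_
    ((natDegree_aeval_X_le g).trans hgD) ?_
  · refine subset_degreeClosure (Or.inl rfl) ((totalDegree_aeval_X_le _ _).trans ?_)
    omega
  · have : Polynomial.aeval (X 0 : MvPolynomial (ZMod 1) k)
        (Polynomial.X ^ Fintype.card k - Polynomial.X : Polynomial k) = X 0 ^ q - X (0 + 1) := by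
      simp [hq, Subsingleton.elim (1 : ZMod 1) 0]
    rw [this]
    refine subset_degreeClosure (Or.inr ⟨0, rfl⟩) ?_
    rw [totalDegree_X_pow_sub_X hq2]
    omega
  · simp
  · intro x hx
    have h1 := hg _ ⟨x, hx, rfl⟩
    rw [e, ← Polynomial.aeval_algHom_apply, aeval_X, chainPoint_zero] at h1
    simpa using h1

/-- The case of the Frobenius chain alone. -/
theorem saturatedFrom_chainSystem_zero [NeZero m] (hP : 2 ≤ P) (hq : Fintype.card k = P ^ m)
    (N : ℕ) :
    SaturatedFrom (chainSystem m P (0 : Polynomial k))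
      (vanishingIdeal k (chainZeros m P (0 : Polynomial k))) N := by
  classical
  set F := chainSystem m P (0 : Polynomial k) with hF
  let S : ((ZMod m → Fin P) → k) →ₗ[k] MvPolynomial (ZMod m) k :=
    Fintype.linearCombination k (reducedMonomial (k := k) (m := m) (P := P))
  let ev : MvPolynomial (ZMod m) k →ₗ[k] (k → k) :=
    LinearMap.funLeft k k (chainPoint m P) ∘ₗ evalₗ k (ZMod m)
  have hev : ∀ g x, ev g x = eval (chainPoint m P x) g := fun _ _ => rfl
  have hdec : ∀ D g, g.totalDegree ≤ D → ∃ v ∈ degreeClosure F D, ∃ c, v + S c = g := by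
    intro D g hg
    obtain ⟨v, hv, r, hr, hvr⟩ :=
      Submodule.mem_sup.1 (mem_degreeClosure_sup_span_reducedMonomial hP 0 hg)
    rw [← Fintype.range_linearCombination] at hr
    obtain ⟨c, rfl⟩ := hr
    exact ⟨v, hv, c, hvr⟩
  have hevV : ∀ D, ∀ v ∈ degreeClosure F D, ev v = 0 := by
    intro D v hv
    ext x
    have := degreeClosure_le_ideal (chainSystem_subset_vanishingIdeal hq 0) D hv
    exact this (chainPoint m P x) ⟨x, by simp, rfl⟩
  -- Every function on k is a polynomial in x_0, which reduces modulo V_D to reduced monomials; V_D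
  -- itself evaluates to zero at the chain points.
  have hsurj : Function.Surjective (ev ∘ₗ S) := by
    intro w
    let u : Polynomial k := Lagrange.interpolate Finset.univ id w
    obtain ⟨v, hv, c, hc⟩ := hdec _ (Polynomial.aeval (X 0) u) le_rfl
    refine ⟨c, ?_⟩
    have h1 := congrArg ev hc
    rw [map_add, hevV _ v hv, zero_add] at h1
    rw [LinearMap.comp_apply, h1]
    ext x
    rw [hev, ← aeval_eq_eval, ← Polynomial.aeval_algHom_apply, aeval_X, chainPoint_zero,
      Polynomial.coe_aeval_eq_eval]
    exact Lagrange.eval_interpolate_at_node w Function.injective_id.injOn (Finset.mem_univ x)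
  -- There are P^m = |k| reduced monomials, so surjectivity gives injectivity.
  have hinj : Function.Injective (ev ∘ₗ S) := by
    refine (LinearMap.injective_iff_surjective_of_finrank_eq_finrank ?_).2 hsurj
    rw [Module.finrank_fintype_fun_eq_card, Module.finrank_fintype_fun_eq_card, Fintype.card_fun,
      Fintype.card_fin, ZMod.card, hq]
  intro D _ g hg hgD
  obtain ⟨v, hv, c, rfl⟩ := hdec D g hgD
  have hc : c = 0 := by
    refine hinj ?_
    rw [map_zero, LinearMap.comp_apply]
    have h1 : ev (v + S c) = 0 := by
      ext x
      exact hg (chainPoint m P x) ⟨x, by simp, rfl⟩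
    rwa [map_add, hevV D v hv, zero_add] at h1
  rwa [hc, map_zero, add_zero]

end Chain

/-! ### Frobenius chains with f nonzero -/

section ChainNonzero

variable {k : Type*} [Field k] {m p : ℕ}

theorem natDegree_mod_le_sub_one {f : Polynomial k} (hf : f ≠ 0) {d : ℕ} (hd : f.natDegree ≤ d)
    (v : Polynomial k) : (v % f).natDegree ≤ d - 1 := by
  by_cases h0 : v % f = 0
  · simp [h0]
  have h2 := Polynomial.degree_mod_lt v hf
  rw [Polynomial.degree_eq_natDegree h0, Polynomial.degree_eq_natDegree hf] at h2
  have h3 : (v % f).natDegree < f.natDegree := by exact_mod_cast h2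
  omega

theorem dvd_sub_mod (v f : Polynomial k) : f ∣ v - v % f := by
  rw [EuclideanDomain.mod_eq_sub_mul_div, sub_sub_cancel]
  exact dvd_mul_right _ _

theorem aeval_mem_degreeClosure_chainSystem {f : Polynomial k} {D : ℕ} (hf : f.natDegree ≤ D)
    {v : Polynomial k} (hv : f ∣ v) (hvD : v.natDegree ≤ D) :
    Polynomial.aeval (X 0) v ∈ degreeClosure (chainSystem m p f) D := by
  obtain ⟨c, rfl⟩ := hv
  rw [mul_comm, map_mul]
  refine mul_mem_degreeClosure (subset_degreeClosure (Or.inl rfl)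
    ((totalDegree_aeval_X_le _ _).trans hf)) _ ?_
  rw [← map_mul, mul_comm]
  exact (totalDegree_aeval_X_le _ _).trans hvD

/-- `x_r ≡ x_0 ^ (p ^ r) mod f(x_0)` holds in `V_D`. -/
theorem X_natCast_sub_aeval_mem (hp : p.Prime) [CharP k p] {f : Polynomial k} (hf : f ≠ 0)
    {d D : ℕ} (hd : f.natDegree ≤ d) (hd0 : d ≠ 0) (hD : d * p ≤ D) (r : ℕ) :
    X (r : ZMod m) - Polynomial.aeval (X 0) (Polynomial.X ^ p ^ r % f) ∈
      degreeClosure (chainSystem m p f) D := by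
  have := Fact.mk hp
  have hp2 := hp.two_le
  have h1 : d * 2 ≤ d * p := Nat.mul_le_mul_left d hp2
  have h2 : 1 * p ≤ d * p := Nat.mul_le_mul_right p (by omega)
  have h3 : (d - 1) * p ≤ d * p := Nat.mul_le_mul_right p (by omega)
  have hfD : f.natDegree ≤ D := by omega
  have hmod := natDegree_mod_le_sub_one hf hd
  induction r with
  | zero =>
    have e : X ((0 : ℕ) : ZMod m) - Polynomial.aeval (X 0) (Polynomial.X ^ p ^ 0 % f) =
        Polynomial.aeval (X 0 : MvPolynomial (ZMod m) k)
          (Polynomial.X - Polynomial.X % f) := by simp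
    rw [e]
    refine aeval_mem_degreeClosure_chainSystem hfD (dvd_sub_mod _ _) ?_
    have := hmod Polynomial.X
    refine (Polynomial.natDegree_sub_le _ _).trans (max_le ?_ (by omega))
    exact Polynomial.natDegree_X_le.trans (by omega)
  | succ r ih =>
    set s := Polynomial.X ^ p ^ r % f with hs
    set t := Polynomial.X ^ p ^ (r + 1) % f with ht
    have hsd : s.natDegree ≤ d - 1 := hmod _
    -- The p-th power of the relation for r reads x_r^p ≡ s(x_0)^p; the chain equation turns x_r^p
    -- into x_{r+1}, and reduction modulo f turns s^p into t. The degrees reach at most max(p, (d -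
    -- 1)p) ≤ dp, whence the bound.
    have e : X ((r + 1 : ℕ) : ZMod m) - Polynomial.aeval (X 0) t =
        (X (r : ZMod m) - Polynomial.aeval (X 0) s) ^ p -
          (X (r : ZMod m) ^ p - X ((r : ZMod m) + 1)) +
          Polynomial.aeval (X 0 : MvPolynomial (ZMod m) k) (s ^ p - t) := by
      rw [sub_pow_char, map_sub, map_pow, Nat.cast_add, Nat.cast_one]
      ring
    have hspd : (s ^ p).natDegree ≤ (d - 1) * p := by
      refine Polynomial.natDegree_pow_le.trans ?_
      rw [mul_comm]
      exact Nat.mul_le_mul_right p hsd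
    rw [e]
    refine Submodule.add_mem _ (Submodule.sub_mem _ ?_ ?_) ?_
    · have e2 : (X (r : ZMod m) - Polynomial.aeval (X 0 : MvPolynomial (ZMod m) k) s) ^ p =
          (X (r : ZMod m) - Polynomial.aeval (X 0) s) ^ (p - 1) *
            (X (r : ZMod m) - Polynomial.aeval (X 0) s) := by
        rw [← pow_succ, Nat.sub_add_cancel hp.one_le]
      rw [e2]
      refine mul_mem_degreeClosure ih _ ?_
      rw [← e2, sub_pow_char]
      refine (totalDegree_sub _ _).trans (max_le ?_ ?_)
      · rw [totalDegree_X_pow]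
        omega
      · rw [← map_pow]
        exact (totalDegree_aeval_X_le _ _).trans (hspd.trans (by omega))
    · refine subset_degreeClosure (Or.inr ⟨_, rfl⟩) ?_
      rw [totalDegree_X_pow_sub_X hp2]
      omega
    · refine aeval_mem_degreeClosure_chainSystem hfD ?_ ?_
      · have a1 : f ∣ (Polynomial.X ^ p ^ r) ^ p - s ^ p :=
          (dvd_sub_mod _ _).trans (sub_dvd_pow_sub_pow _ _ p)
        have a2 : f ∣ Polynomial.X ^ p ^ (r + 1) - t := dvd_sub_mod _ _
        rw [← pow_mul, ← pow_succ] at a1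
        have := dvd_sub a2 a1
        rwa [sub_sub_sub_cancel_left] at this
      · have : t.natDegree ≤ d - 1 := hmod _
        exact (Polynomial.natDegree_sub_le _ _).trans (max_le (by omega) (by omega))

/-- Modulo `V_D` every polynomial of degree at most `D` is a polynomial in `x_0` of degree less
than `d`. -/
theorem exists_sub_aeval_mem_degreeClosure [NeZero m] (hp : p.Prime) [CharP k p] {f : Polynomial k}
    (hf : f ≠ 0) {d D : ℕ} (hd : f.natDegree ≤ d) (hd0 : d ≠ 0) (hD : d * p ≤ D)
    {g : MvPolynomial (ZMod m) k} (hg : g.totalDegree ≤ D) :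
    ∃ u : Polynomial k, u.natDegree ≤ d - 1 ∧
      g - Polynomial.aeval (X 0) u ∈ degreeClosure (chainSystem m p f) D := by
  have hp2 := hp.two_le
  have h1 : d * 2 ≤ d * p := Nat.mul_le_mul_left d hp2
  have hfD : f.natDegree ≤ D := by omega
  have hmod := natDegree_mod_le_sub_one hf hd
  have key : ∀ n, ∀ b : ZMod m →₀ ℕ, b.degree = n → n ≤ D → ∃ u : Polynomial k,
      u.natDegree ≤ d - 1 ∧ monomial b 1 - Polynomial.aeval (X 0) u ∈
        degreeClosure (chainSystem m p f) D := by
    intro n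
    induction n with
    | zero =>
      intro b hb _
      obtain rfl := (Finsupp.degree_eq_zero_iff b).1 hb
      exact ⟨1, by simp, by simp⟩
    | succ n ih =>
      intro b hb hn
      obtain ⟨j, hj⟩ : ∃ j, b j ≠ 0 := by
        by_contra! h
        rw [(Finsupp.degree_eq_zero_iff b).2 (Finsupp.ext h)] at hb
        omega
      obtain ⟨b', rfl⟩ : ∃ b', b = b' + Finsupp.single j 1 :=
        ⟨b - Finsupp.single j 1, (tsub_add_cancel_of_le (by simp; omega)).symm⟩
      rw [map_add, Finsupp.degree_single] at hb
      obtain ⟨u, hu, hmem⟩ := ih b' (by omega) (by omega)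
      have hj := X_natCast_sub_aeval_mem (m := m) hp hf hd hd0 hD j.val
      rw [ZMod.natCast_zmod_val] at hj
      set s := Polynomial.X ^ p ^ j.val % f
      have hsd : s.natDegree ≤ d - 1 := hmod _
      have hsu : (s * u).natDegree ≤ (d - 1) + (d - 1) :=
        Polynomial.natDegree_mul_le.trans (by omega)
      -- One variable is peeled off at a time. The product s * u has degree at most 2(d - 1), which
      -- fits since 2d ≤ dp ≤ D.
      have e : monomial (b' + Finsupp.single j 1) 1 - Polynomial.aeval (X 0) (s * u % f) =
          X j * (monomial b' 1 - Polynomial.aeval (X 0) u) +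
          Polynomial.aeval (X 0) u * (X j - Polynomial.aeval (X 0) s) +
          Polynomial.aeval (X 0 : MvPolynomial (ZMod m) k) (s * u - s * u % f) := by
        have : monomial (b' + Finsupp.single j 1) (1 : k) = monomial b' 1 * X j := by
          rw [X, monomial_mul, mul_one]
        rw [this, map_sub, map_mul]
        ring
      refine ⟨s * u % f, hmod _, ?_⟩
      rw [e]
      refine Submodule.add_mem _ (Submodule.add_mem _ (mul_mem_degreeClosure hmem _ ?_)
        (mul_mem_degreeClosure hj _ ?_)) (aeval_mem_degreeClosure_chainSystem hfD
          (dvd_sub_mod _ _) ?_)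
      · refine (totalDegree_mul _ _).trans ?_
        have a1 : (monomial b' (1 : k)).totalDegree ≤ n := by
          refine (totalDegree_monomial_le _ _).trans ?_
          change b'.degree ≤ n
          omega
        have a2 := (totalDegree_aeval_X_le (0 : ZMod m) u).trans hu
        have a3 := totalDegree_sub (monomial b' (1 : k)) (Polynomial.aeval (X 0) u)
        rw [totalDegree_X]
        omega
      · refine (totalDegree_mul _ _).trans ?_
        have a1 := (totalDegree_aeval_X_le (0 : ZMod m) u).trans hu
        have a2 := (totalDegree_aeval_X_le (0 : ZMod m) s).trans hsd
        have a3 := totalDegree_sub (X j : MvPolynomial (ZMod m) k) (Polynomial.aeval (X 0) s)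
        rw [totalDegree_X] at a3
        omega
      · have := hmod (s * u)
        exact (Polynomial.natDegree_sub_le _ _).trans (max_le (by omega) (by omega))
  choose! u hu hmem using fun b : ZMod m →₀ ℕ => key _ b rfl
  refine ⟨∑ a ∈ g.support, coeff a g • u a,
    Polynomial.natDegree_sum_le_of_forall_le _ _ fun a ha =>
      (Polynomial.natDegree_smul_le _ _).trans (hu a ((le_totalDegree ha).trans hg)), ?_⟩
  have e : g - Polynomial.aeval (X 0) (∑ a ∈ g.support, coeff a g • u a) =
      ∑ a ∈ g.support, coeff a g • (monomial a 1 - Polynomial.aeval (X 0) (u a)) := by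
    simp only [map_sum, map_smul, smul_sub, Finset.sum_sub_distrib]
    congr 1
    conv_lhs => rw [g.as_sum]
    exact Finset.sum_congr rfl fun a _ => by rw [smul_monomial, smul_eq_mul, mul_one]
  rw [e]
  exact Submodule.sum_mem _ fun a ha =>
    Submodule.smul_mem _ _ (hmem a ((le_totalDegree ha).trans hg))

theorem saturatedFrom_chainSystem [Fintype k] [NeZero m] (hp : p.Prime) (hq : Fintype.card k = p ^ m)
    (f : Polynomial k) {d : ℕ} (hd : f.natDegree ≤ d) :
    SaturatedFrom (chainSystem m p f) (vanishingIdeal k (chainZeros m p f)) (d * p) := by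
  have := Fact.mk hp
  have : CharP k p := charP_of_card_eq_prime_pow hq
  have hp2 := hp.two_le
  by_cases hf : f = 0
  · subst hf
    exact saturatedFrom_chainSystem_zero hp2 hq _
  intro D hD g hg hgD
  -- Here f is a nonzero constant, and V_D contains everything of degree at most D.
  by_cases hd0 : d = 0
  · obtain ⟨c, rfl⟩ : ∃ c, f = Polynomial.C c :=
      ⟨_, Polynomial.eq_C_of_natDegree_eq_zero (by omega)⟩
    refine mem_degreeClosure_of_C_mem (c := c) (by simpa using hf) ?_ hgD
    refine subset_degreeClosure (Or.inl ?_) (by simp)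
    rw [Polynomial.aeval_C]
    rfl
  have h1 : d * 2 ≤ d * p := Nat.mul_le_mul_left d hp2
  have h2 : 1 * p ≤ d * p := Nat.mul_le_mul_right p (by omega)
  obtain ⟨u, hu, hmem⟩ := exists_sub_aeval_mem_degreeClosure hp hf hd hd0 hD hgD
  rw [← sub_add_cancel g (Polynomial.aeval (X 0) u)]
  refine Submodule.add_mem _ hmem ?_
  -- X ^ q - X may have degree above D. Its representative w comes from going once round the chain:
  -- the relation for r = m concerns x_m = x_0.
  refine aeval_X_zero_mem_degreeClosure (f := f)
    (w := Polynomial.X ^ p ^ m % f - Polynomial.X)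
    (aeval_mem_degreeClosure_chainSystem (by omega) dvd_rfl (by omega)) ?_ ?_ (by omega) ?_
  · have := X_natCast_sub_aeval_mem (m := m) hp hf hd hd0 hD m
    rw [ZMod.natCast_self] at this
    rw [map_sub, Polynomial.aeval_X, ← neg_sub]
    exact Submodule.neg_mem _ this
  · rw [hq, sub_sub_sub_cancel_right]
    exact dvd_sub_mod _ _
  · intro x hx
    have a1 := hg (chainPoint m p x) ⟨x, hx, rfl⟩
    have a2 := degreeClosure_le_ideal (chainSystem_subset_vanishingIdeal hq f) D hmem
      (chainPoint m p x) ⟨x, hx, rfl⟩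
    rw [map_sub, a1, zero_sub, neg_eq_zero, ← Polynomial.aeval_algHom_apply, aeval_X,
      chainPoint_zero] at a2
    simpa using a2

end ChainNonzero

/-! ### Undoing the linear changes ρ and λ -/

section ChainSubst

variable {k : Type*} [Field k] {n m P : ℕ}

/-- The linear substitution `x_{i,j} ↦ ∑ l, A i l ^ (P ^ j) * x_{l,j}`. -/
noncomputable def chainSubst (m P : ℕ) (A : Matrix (Fin n) (Fin n) k) :
    MvPolynomial (Fin n × ZMod m) k →ₐ[k] MvPolynomial (Fin n × ZMod m) k :=
  aeval fun x => ∑ l, C (A x.1 l ^ P ^ x.2.val) * X (l, x.2)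

theorem chainSubst_X (A : Matrix (Fin n) (Fin n) k) (i : Fin n) (j : ZMod m) :
    chainSubst m P A (X (i, j)) = ∑ l, C (A i l ^ P ^ j.val) * X (l, j) :=
  aeval_X _ _

theorem totalDegree_chainSubst_le (A : Matrix (Fin n) (Fin n) k)
    (f : MvPolynomial (Fin n × ZMod m) k) : (chainSubst m P A f).totalDegree ≤ f.totalDegree := by
  unfold chainSubst
  refine totalDegree_aeval_le_of_totalDegree_le_one (fun x => ?_) f
  exact totalDegree_sum_C_mul_X_le _ _ fun l => (l, x.2)

theorem chainSubst_one (hP : P ≠ 0) (f : MvPolynomial (Fin n × ZMod m) k) :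
    chainSubst m P (1 : Matrix (Fin n) (Fin n) k) f = f := by
  have : chainSubst m P (1 : Matrix (Fin n) (Fin n) k) = AlgHom.id k _ := by
    ext1 ⟨i, j⟩
    rw [chainSubst_X, AlgHom.id_apply, Finset.sum_eq_single i]
    · simp
    · intro l _ hl
      rw [Matrix.one_apply_ne' hl, zero_pow (pow_ne_zero _ hP), C_0, zero_mul]
    · simp
  rw [this, AlgHom.id_apply]

/-- Raising entries to the power P ^ j is additive in characteristic p, so it respects matrix
products. -/
theorem chainSubst_chainSubst {p r : ℕ} (hp : p.Prime) [CharP k p] (hP : P = p ^ r)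
    (A B : Matrix (Fin n) (Fin n) k) (f : MvPolynomial (Fin n × ZMod m) k) :
    chainSubst m P A (chainSubst m P B f) = chainSubst m P (B * A) f := by
  have := Fact.mk hp
  have : (chainSubst m P A).comp (chainSubst m P B) = chainSubst m P (B * A) := by
    ext1 ⟨i, j⟩
    rw [AlgHom.comp_apply, chainSubst_X, chainSubst_X, map_sum]
    have h1 : ∀ l, chainSubst m P A (C (B i l ^ P ^ j.val) * X (l, j)) =
        ∑ x, C (B i l ^ P ^ j.val * A l x ^ P ^ j.val) * X (x, j) := by
      intro l
      rw [map_mul, chainSubst_X, Finset.mul_sum]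
      refine Finset.sum_congr rfl fun x _ => ?_
      rw [← algebraMap_eq, AlgHom.commutes, algebraMap_eq, C_mul, mul_assoc]
    simp only [h1]
    rw [Finset.sum_comm]
    refine Finset.sum_congr rfl fun x _ => ?_
    rw [← Finset.sum_mul, Matrix.mul_apply, hP, ← pow_mul, sum_pow_char_pow, map_sum]
    simp only [mul_pow]
  rw [← this, AlgHom.comp_apply]

/-- The P-th power of the twisted form at j has the coefficients of the form at j + 1; at the
wrap-around this is a^q = a. The images are thus scalar combinations of chain equations. -/
theorem chainSubst_frobenius [Fintype k] [NeZero m] {p r : ℕ} (hp : p.Prime) [CharP k p]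
    (hP : P = p ^ r) (hq : Fintype.card k = P ^ m) (A : Matrix (Fin n) (Fin n) k) (i : Fin n)
    (j : ZMod m) :
    chainSubst m P A (X (i, j) ^ P - X (i, j + 1)) =
      ∑ l, C (A i l ^ P ^ (j + 1).val) * (X (l, j) ^ P - X (l, j + 1)) := by
  have := Fact.mk hp
  rw [map_sub, map_pow, chainSubst_X, chainSubst_X]
  have : (∑ l, C (A i l ^ P ^ j.val) * X (l, j) : MvPolynomial (Fin n × ZMod m) k) ^ P =
      ∑ l, (C (A i l ^ P ^ j.val) * X (l, j)) ^ P := by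
    rw [hP, sum_pow_char_pow]
  rw [this, ← Finset.sum_sub_distrib]
  refine Finset.sum_congr rfl fun l _ => ?_
  rw [mul_pow, ← C_pow, ← pow_pow_val_add_one hq, mul_sub]

/-- At j = 0 the twist is trivial, so the substitution is A itself. -/
theorem chainSubst_aeval_X_zero [NeZero m] (A : Matrix (Fin n) (Fin n) k) (i : Fin n)
    (f : Polynomial k) :
    chainSubst m P A (Polynomial.aeval (X (i, 0)) f) =
      toChainVariables m (compLinear (Polynomial.aeval (X i) f) A) := by
  rw [← Polynomial.aeval_algHom_apply, chainSubst_X, toChainVariables, compLinear,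
    ← Polynomial.aeval_algHom_apply, ← Polynomial.aeval_algHom_apply, bind₁_X_right]
  simp [map_sum]

theorem toChainVariables_linearComp (A : Matrix (Fin n) (Fin n) k)
    (c : Fin n → MvPolynomial (Fin n) k) (i : Fin n) :
    toChainVariables m (linearComp A c i) = ∑ j, A i j • toChainVariables m (c j) := by
  simp only [toChainVariables, linearComp, map_sum, map_mul, rename_C, smul_eq_C_mul]

theorem linearComp_linearComp (A B : Matrix (Fin n) (Fin n) k)
    (c : Fin n → MvPolynomial (Fin n) k) :
    linearComp A (linearComp B c) = linearComp (A * B) c := by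
  ext1 i
  simp only [linearComp, Finset.mul_sum, Matrix.mul_apply, map_sum, Finset.sum_mul, C_mul]
  rw [Finset.sum_comm]
  simp only [mul_assoc]

theorem linearComp_one (c : Fin n → MvPolynomial (Fin n) k) :
    linearComp (1 : Matrix (Fin n) (Fin n) k) c = c := by
  ext1 i
  rw [linearComp, Finset.sum_eq_single i]
  · simp
  · intro l _ hl
    rw [Matrix.one_apply_ne' hl, C_0, zero_mul]
  · simp

/-- Saturation for a system `ρ ∘ f ∘ lam` together with the equations `x_{i,j} ^ P = x_{i,j+1}`,
from saturation for the systems of one `f i` each. -/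
theorem exists_saturatedFrom_union_frobeniusEquations [Fintype k] [NeZero m] {p r d N : ℕ}
    (hp : p.Prime) [CharP k p] (hP : P = p ^ r) (hP2 : 2 ≤ P) (hq : Fintype.card k = P ^ m)
    (g : Fin n → MvPolynomial (Fin n) k) (hd : ∀ i, (g i).totalDegree ≤ d)
    (f : Fin n → Polynomial k) (ρ lam : Matrix.GeneralLinearGroup (Fin n) k)
    (hg : g = linearComp (ρ : Matrix (Fin n) (Fin n) k)
      (fun i => compLinear (Polynomial.aeval (X i : MvPolynomial (Fin n) k) (f i))
        (lam : Matrix (Fin n) (Fin n) k)))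
    (hdN : d ≤ N)
    (hblock : ∀ u : Polynomial k, u.natDegree ≤ d →
      SaturatedFrom (chainSystem m P u) (vanishingIdeal k (chainZeros m P u)) N) :
    ∃ I : Ideal (MvPolynomial (Fin n × ZMod m) k),
      Set.range (fun i => toChainVariables m (g i)) ∪ frobeniusEquations n m P k ⊆ I ∧
      SaturatedFrom (Set.range (fun i => toChainVariables m (g i)) ∪ frobeniusEquations n m P k)
        I N := by
  set c : Fin n → MvPolynomial (Fin n) k := fun i =>
    compLinear (Polynomial.aeval (X i : MvPolynomial (Fin n) k) (f i))
      (lam : Matrix (Fin n) (Fin n) k) with hc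
  let φ := chainSubst (n := n) m P (↑lam⁻¹ : Matrix (Fin n) (Fin n) k)
  let ψ := chainSubst (n := n) m P (lam : Matrix (Fin n) (Fin n) k)
  have hψφ : ∀ x, ψ (φ x) = x := fun x => by
    rw [chainSubst_chainSubst hp hP, Units.inv_mul, chainSubst_one (by omega)]
  have hφψ : ∀ x, φ (ψ x) = x := fun x => by
    rw [chainSubst_chainSubst hp hP, Units.mul_inv, chainSubst_one (by omega)]
  have hψf : ∀ i, ψ (Polynomial.aeval (X (i, 0)) (f i)) = toChainVariables m (c i) := fun i =>
    chainSubst_aeval_X_zero _ _ _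
  have hcg : ∀ i, toChainVariables m (c i) =
      ∑ j, (↑ρ⁻¹ : Matrix (Fin n) (Fin n) k) i j • toChainVariables m (g j) := by
    intro i
    rw [← toChainVariables_linearComp, hg, linearComp_linearComp, Units.inv_mul, linearComp_one]
  have hgd : ∀ i, (toChainVariables m (g i)).totalDegree ≤ d := fun i =>
    (totalDegree_rename_le _ _).trans (hd i)
  -- The bound on f_i is recovered from the g_j by inverting ρ and λ, neither of which raises
  -- degrees.
  have hfd : ∀ i, (f i).natDegree ≤ d := by
    intro i
    refine (natDegree_le_totalDegree_aeval_X (i, (0 : ZMod m)) (f i)).trans ?_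
    rw [← hφψ (Polynomial.aeval (X (i, 0)) (f i)), hψf, hcg]
    exact (totalDegree_chainSubst_le _ _).trans (totalDegree_finsetSum_le fun j _ =>
      (totalDegree_smul_le _ _).trans (hgd j))
  set Z := blockPoints fun i => chainZeros m P (f i)
  have hsub : ∀ i, ∀ e ∈ chainSystem m P (f i), rename (Prod.mk i) e ∈ vanishingIdeal k Z := by
    intro i e he
    refine mem_vanishingIdeal_iff.2 fun y hy => ?_
    rw [aeval_rename]
    exact chainSystem_subset_vanishingIdeal hq (f i) he _ (hy i)
  have hfrob : ∀ i j, (X (i, j) ^ P - X (i, j + 1) : MvPolynomial (Fin n × ZMod m) k) =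
      rename (Prod.mk i) (X j ^ P - X (j + 1)) := by simp
  have hfI : ∀ i, Polynomial.aeval (X (i, 0)) (f i) ∈ vanishingIdeal k Z := by
    intro i
    have := hsub i _ (Or.inl rfl)
    rwa [← Polynomial.aeval_algHom_apply, rename_X] at this
  refine ⟨(vanishingIdeal k Z).comap φ, ?_, (SaturatedFrom.iUnion_rename
    (fun i => chainSystem m P (f i)) _ fun i => hblock (f i) (hfd i)).comap φ ψ
    (totalDegree_chainSubst_le _) (totalDegree_chainSubst_le _) hψφ ?_⟩
  · rintro _ (⟨i, rfl⟩ | ⟨i, j, rfl⟩)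
    · change φ (toChainVariables m (g i)) ∈ vanishingIdeal k Z
      rw [hg, toChainVariables_linearComp, map_sum]
      refine Ideal.sum_mem _ fun j _ => ?_
      rw [map_smul, ← hψf, hφψ]
      exact Submodule.smul_of_tower_mem _ _ (hfI j)
    · change φ (X (i, j) ^ P - X (i, j + 1)) ∈ vanishingIdeal k Z
      rw [chainSubst_frobenius hp hP hq]
      refine Ideal.sum_mem _ fun l _ => Ideal.mul_mem_left _ _ ?_
      rw [hfrob]
      exact hsub l _ (Or.inr ⟨j, rfl⟩)
  · rintro D hD e he heD
    obtain ⟨i, e, (rfl | ⟨j, rfl⟩), rfl⟩ := Set.mem_iUnion.1 he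
    · rw [← Polynomial.aeval_algHom_apply, rename_X, hψf, hcg]
      exact Submodule.sum_mem _ fun j _ => Submodule.smul_mem _ _
        (subset_degreeClosure (Or.inl ⟨j, rfl⟩) ((hgd j).trans (hdN.trans hD)))
    · rw [← hfrob, totalDegree_X_pow_sub_X hP2] at heD
      rw [← hfrob, chainSubst_frobenius hp hP hq]
      refine Submodule.sum_mem _ fun l _ => ?_
      rw [← smul_eq_C_mul]
      refine Submodule.smul_mem _ _ (subset_degreeClosure (Or.inr ⟨l, j, rfl⟩) ?_)
      rwa [totalDegree_X_pow_sub_X hP2]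

end ChainSubst

/-! ### The two bounds -/

theorem theorem5 {k : Type*} [Field k] [Fintype k] (n p m q d : ℕ)
    (hp : p.Prime) (hq : q = p ^ m) (hk : Fintype.card k = q)
    (g : Fin n → MvPolynomial (Fin n) k) (hd : ∀ i, (g i).totalDegree ≤ d)
    (f : Fin n → Polynomial k) (ρ lam : Matrix.GeneralLinearGroup (Fin n) k)
    (hg : g = linearComp (ρ : Matrix (Fin n) (Fin n) k)
      (fun i => compLinear (Polynomial.aeval (X i : MvPolynomial (Fin n) k) (f i))
        (lam : Matrix (Fin n) (Fin n) k))) :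
    lastFallDegree (Set.range g ∪ fieldEquations n q k) ≤ ((d + q : ℕ) : ℕ∞) ∧
    lastFallDegree (Set.range (fun i => toChainVariables m (g i)) ∪ frobeniusEquations n m p k)
      ≤ ((d * p : ℕ) : ℕ∞) := by
  have hkq : Fintype.card k = p ^ m := hk.trans hq
  have := Fact.mk hp
  have : CharP k p := charP_of_card_eq_prime_pow hkq
  have hq2 : 2 ≤ q := hk ▸ Fintype.one_lt_card
  -- For m = 0 the field would have a single element.
  have : NeZero m := ⟨by
    rintro rfl
    rw [hq, pow_zero] at hq2
    omega⟩
  constructor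
  -- With P = q and indices in `ZMod 1`, where j + 1 = j, the chain equations are the field
  -- equations; renaming removes the idle index.
  · obtain ⟨I, hI, hsat⟩ := exists_saturatedFrom_union_frobeniusEquations (m := 1) (N := d + q)
      hp hq hq2 (by rw [hk, pow_one]) g hd f ρ lam hg (by omega)
      fun u hu => saturatedFrom_chainSystem_one hk u hu
    refine (hsat.comap (F := Set.range g ∪ fieldEquations n q k)
      (rename fun i => (i, (0 : ZMod 1))) (rename Prod.fst) (totalDegree_rename_le _)
      (totalDegree_rename_le _) (fun x => ?_) ?_).lastFallDegree_le ?_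
    · rw [rename_rename]
      exact rename_id_apply x
    · rintro D hD _ (⟨i, rfl⟩ | ⟨i, j, rfl⟩) hdeg
      · change rename Prod.fst (rename (fun i => (i, (0 : ZMod 1))) (g i)) ∈ _
        rw [rename_rename]
        change rename id (g i) ∈ _
        rw [rename_id_apply]
        exact subset_degreeClosure (Or.inl ⟨i, rfl⟩) ((hd i).trans (by omega))
      · rw [map_sub, map_pow, rename_X, rename_X]
        refine subset_degreeClosure (Or.inr ⟨i, rfl⟩) ?_
        rw [totalDegree_X_pow_sub_X hq2]
        omega
    · rintro _ (⟨i, rfl⟩ | ⟨i, rfl⟩)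
      · exact hI (Or.inl ⟨i, rfl⟩)
      · refine hI (Or.inr ⟨i, 0, ?_⟩)
        simp [Subsingleton.elim (1 : ZMod 1) 0]
  · obtain ⟨I, hI, hsat⟩ := exists_saturatedFrom_union_frobeniusEquations (r := 1) (N := d * p)
      hp (pow_one p).symm hp.two_le hkq g hd f ρ lam hg (Nat.le_mul_of_pos_right d hp.pos)
      fun u hu => saturatedFrom_chainSystem hp hkq u hu
    exact hsat.lastFallDegree_le hI
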